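/- Let $n\ge 0$ be an integer and let $A_n$ be the positive braid monoid on $n+1$ strands, that is, the Artin–Tits monoid of type $A_n$, given by the monoid presentation $$A_n=\left\langle a_1,\dots,a_n \;\middle|\; a_ia_j=a_ja_i \text{ if } |i-j|>1,\quad a_ia_ja_i=a_ja_ia_j \text{ if } |i-j|=1\right\rangle$$ (so $A_0$ is the trivial monoid). Its atoms, i.e. the nontrivial elements that are not a product of two nontrivial elements, are exactly the standard generators $a_1,\dots,a_n$. For $k\ge 0$ let $\alpha_k$ be the number of elements of $A_n$ of length $k$, where the length of an element is the smallest length of a word in the atoms representing it; each $\alpha_k$ is finite. Let $g_{A_n}(t)=\sum_{k\ge 0}\alpha_k t^k\in\mathbb Z[[t]]$ be the growth function of $A_n$ with respect to its atoms. Let $\mathcal M^{\mathcal A}_n$ be the $(n+1)\times(n+1)$ matrix over $\mathbb Z[t]$ whose entry $(i,j)$ is $t^{\binom{j-i+1}{2}}$ if $j-i+1\ge 0$ and $0$ otherwise, where $\binom{k}{2}=\frac{k(k-1)}{2}$ for every integer $k\ge 0$. Then the determinant $|\mathcal M^{\mathcal A}_n|$ is invertible in $\mathbb Z[[t]]$,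 and $$g_{A_n}(t)=|\mathcal M^{\mathcal A}_n|^{-1}.$$ -/

import Mathlib

open scoped Polynomial PowerSeries

/-- The defining relations of the positive braid monoid on `n + 1` strands (the Artin–Tits monoid of
type `A_n`) on the generators `a_i`, `i : Fin n`: far commutation and the braid relation. -/
inductive BraidRel (n : ℕ) : FreeMonoid (Fin n) → FreeMonoid (Fin n) → Prop
  | comm (i j : Fin n) (h : 1 < |(i : ℤ) - (j : ℤ)|) :
      BraidRel n (FreeMonoid.of i * FreeMonoid.of j) (FreeMonoid.of j * FreeMonoid.of i)
  | braid (i j : Fin n) (h : |(i : ℤ) - (j : ℤ)| = 1) :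
      BraidRel n (FreeMonoid.of i * FreeMonoid.of j * FreeMonoid.of i)
        (FreeMonoid.of j * FreeMonoid.of i * FreeMonoid.of j)

/-- The positive braid monoid on `n + 1` strands, i.e. the Artin–Tits monoid of type `A_n`, given by
its standard presentation with `n` generators. -/
abbrev BraidMonoid (n : ℕ) : Type := PresentedMonoid (BraidRel n)

/-- The atoms of a monoid: the nontrivial elements that are not a product of two nontrivial
elements. -/
def monoidAtoms (M : Type*) [Monoid M] : Set M :=
  {a | a ≠ 1 ∧ ∀ x y : M, a = x * y → x = 1 ∨ y = 1}

/-- The set `M_k` of elements of length `k` with respect to a set `S` of generators: those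
for which `k` is the smallest length of a word in `S` that represents the element. -/
def wordSphere {M : Type*} [Monoid M] (S : Set M) (k : ℕ) : Set M :=
  {a | IsLeast {l : ℕ | ∃ w : List M, (∀ s ∈ w, s ∈ S) ∧ w.prod = a ∧ w.length = l} k}

/-- The growth function `∑ |M_k| t ^ k` of a monoid with respect to a set `S` of generators, as a
formal power series (meaningful when the sets `M_k` are finite). -/
noncomputable def growthSeries {M : Type*} [Monoid M] (S : Set M) : ℤ⟦X⟧ :=
  PowerSeries.mk fun k => ((wordSphere S k).ncard : ℤ)

/-- The square matrix of order `n + 1` with entry `t ^ (j - i + 1).choose 2` at `(i, j)` if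
`j - i + 1 ≥ 0`, and `0` otherwise (both indices start at `0` here, which does not change
`j - i + 1`). -/
noncomputable def typeAMatrix (n : ℕ) : Matrix (Fin (n + 1)) (Fin (n + 1)) ℤ[X] :=
  Matrix.of fun i j =>
    if (i : ℕ) ≤ (j : ℕ) + 1 then Polynomial.X ^ ((j : ℕ) + 1 - (i : ℕ)).choose 2 else 0

/-! Write $\Delta_{p,m}$ for the Garside element of the run $a_p,\dots,a_{p+m-1}$, of length
$\binom{m+1}{2}$. It is the least common multiple of the run for left divisibility
(`garside_dvd_iff`). This rests on Garside's reduction lemma (`meet_of_gen_mul_eq`), which also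
gives left cancellation.

Let $D(p,m)$ count by length the braids divisible by none of $a_0,\dots,a_{p-1}$ but by all of
$a_p,\dots,a_{p+m-1}$. Removing $\Delta_{p+1,m}$ and sorting by divisibility by $a_p$ gives
$D(p+1,m)=t^{\binom{m+1}{2}}D(p,0)-D(p,m+1)$. Determinants of blocks of the matrix, with shifted
last column, obey the same recursion (`det_shiftedMatrix_succ`). Since $D(0,m)=t^{\binom{m+1}{2}}g$
and only $1$ is divisible by no generator, $1=D(n,0)=g\cdot|\mathcal M|$. -/

namespace BraidMonoid

variable {n : ℕ}

/-! ### Generators and length. -/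

/-- The standard generators of the positive braid monoid. -/
abbrev gen (i : Fin n) : BraidMonoid n := PresentedMonoid.of (BraidRel n) i

/-- Two indices whose generators commute by a defining relation. -/
def Far (i j : Fin n) : Prop := (i : ℕ) + 1 < j ∨ (j : ℕ) + 1 < i

/-- Two indices whose generators satisfy the braid relation. -/
def Adj (i j : Fin n) : Prop := (i : ℕ) + 1 = j ∨ (j : ℕ) + 1 = i

theorem far_iff (i j : Fin n) : Far i j ↔ 1 < |(i : ℤ) - (j : ℤ)| := by
  unfold Far
  rcases abs_cases ((i : ℤ) - (j : ℤ)) with h | h <;> omega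

theorem adj_iff (i j : Fin n) : Adj i j ↔ |(i : ℤ) - (j : ℤ)| = 1 := by
  unfold Adj
  rcases abs_cases ((i : ℤ) - (j : ℤ)) with h | h <;> omega

theorem Far.symm {i j : Fin n} (h : Far i j) : Far j i := Or.symm h

theorem Adj.symm {i j : Fin n} (h : Adj i j) : Adj j i := Or.symm h

theorem eq_or_far_or_adj (i j : Fin n) : i = j ∨ Far i j ∨ Adj i j := by
  unfold Far Adj
  rw [Fin.ext_iff]
  omega

theorem gen_comm {i j : Fin n} (h : Far i j) : gen i * gen j = gen j * gen i :=
  PresentedMonoid.mk_eq_mk_iff.2 (ConGen.Rel.of _ _ (BraidRel.comm i j ((far_iff i j).1 h)))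

theorem gen_braid {i j : Fin n} (h : Adj i j) :
    gen i * gen j * gen i = gen j * gen i * gen j :=
  PresentedMonoid.mk_eq_mk_iff.2 (ConGen.Rel.of _ _ (BraidRel.braid i j ((adj_iff i j).1 h)))

theorem gen_comm_assoc {i j : Fin n} (h : Far i j) (x : BraidMonoid n) :
    gen i * (gen j * x) = gen j * (gen i * x) := by
  rw [← mul_assoc, gen_comm h, mul_assoc]

theorem gen_braid_assoc {i j : Fin n} (h : Adj i j) (x : BraidMonoid n) :
    gen i * (gen j * (gen i * x)) = gen j * (gen i * (gen j * x)) := by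
  rw [← mul_assoc, ← mul_assoc, gen_braid h, mul_assoc, mul_assoc]

/-- The length homomorphism, written multiplicatively. -/
def lenHom (n : ℕ) : BraidMonoid n →* Multiplicative ℕ :=
  PresentedMonoid.lift (fun _ => Multiplicative.ofAdd 1) (by
    rintro a b (⟨i, j, h⟩ | ⟨i, j, h⟩) <;> simp)

/-- The length of a positive braid. -/
def len (x : BraidMonoid n) : ℕ := (lenHom n x).toAdd

@[simp] theorem len_one : len (1 : BraidMonoid n) = 0 := by simp [len]

@[simp] theorem len_mul (x y : BraidMonoid n) : len (x * y) = len x + len y := by simp [len]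

@[simp] theorem len_gen (i : Fin n) : len (gen i) = 1 := by
  simp [len, lenHom, gen]

theorem len_mk (w : FreeMonoid (Fin n)) :
    len (PresentedMonoid.mk (BraidRel n) w) = w.length := by
  induction w using FreeMonoid.inductionOn' with
  | one => simp
  | of_mul i w ih =>
    rw [map_mul, len_mul, ih, FreeMonoid.length_mul]
    exact congrArg (· + w.length) (len_gen i)

/-! ### Garside's reduction lemma and left cancellation. -/

/-- The conclusion of the reduction lemma: `gen i * x` and `gen j * y` are equal because both are
multiples of the least common multiple of `gen i` and `gen j`. -/
def Meet (i j : Fin n) (x y : BraidMonoid n) : Prop :=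
  (i = j ∧ x = y) ∨
  (Far i j ∧ ∃ z, x = gen j * z ∧ y = gen i * z) ∨
  (Adj i j ∧ ∃ z, x = gen j * (gen i * z) ∧ y = gen i * (gen j * z))

theorem Meet.symm {i j : Fin n} {x y : BraidMonoid n} (h : Meet i j x y) : Meet j i y x := by
  rcases h with ⟨rfl, rfl⟩ | ⟨h, z, rfl, rfl⟩ | ⟨h, z, rfl, rfl⟩
  · exact Or.inl ⟨rfl, rfl⟩
  · exact Or.inr (Or.inl ⟨h.symm, z, rfl, rfl⟩)
  · exact Or.inr (Or.inr ⟨h.symm, z, rfl, rfl⟩)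

theorem Meet.mul_right {i j : Fin n} {x y : BraidMonoid n} (h : Meet i j x y)
    (w : BraidMonoid n) : Meet i j (x * w) (y * w) := by
  rcases h with ⟨rfl, rfl⟩ | ⟨h, z, rfl, rfl⟩ | ⟨h, z, rfl, rfl⟩
  · exact Or.inl ⟨rfl, rfl⟩
  · exact Or.inr (Or.inl ⟨h, z * w, by simp only [mul_assoc], by simp only [mul_assoc]⟩)
  · exact Or.inr (Or.inr ⟨h, z * w, by simp only [mul_assoc], by simp only [mul_assoc]⟩)

theorem not_far_self (i : Fin n) : ¬ Far i i := by unfold Far; omega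

theorem not_adj_self (i : Fin n) : ¬ Adj i i := by unfold Adj; omega

theorem Far.not_adj {i j : Fin n} (h : Far i j) : ¬ Adj i j := by unfold Far Adj at *; omega

theorem Meet.eq {i : Fin n} {x y : BraidMonoid n} (h : Meet i i x y) : x = y := by
  rcases h with ⟨_, h⟩ | ⟨h, _⟩ | ⟨h, _⟩
  · exact h
  · exact absurd h (not_far_self i)
  · exact absurd h (not_adj_self i)

theorem Meet.of_far {i j : Fin n} {x y : BraidMonoid n} (h : Meet i j x y) (hij : Far i j) :
    ∃ z, x = gen j * z ∧ y = gen i * z := by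
  rcases h with ⟨rfl, _⟩ | ⟨_, h⟩ | ⟨h, _⟩
  · exact absurd hij (not_far_self i)
  · exact h
  · exact absurd h hij.not_adj

theorem Meet.of_adj {i j : Fin n} {x y : BraidMonoid n} (h : Meet i j x y) (hij : Adj i j) :
    ∃ z, x = gen j * (gen i * z) ∧ y = gen i * (gen j * z) := by
  rcases h with ⟨rfl, _⟩ | ⟨h, _⟩ | ⟨_, h⟩
  · exact absurd hij (not_adj_self i)
  · exact absurd hij h.not_adj
  · exact h

/-- The reduction lemma for products of length at most `N`. -/
def ReducesUpTo (n N : ℕ) : Prop :=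
  ∀ (i j : Fin n) (x y : BraidMonoid n), len x < N → gen i * x = gen j * y → Meet i j x y

/-- Repeated reduction of shorter equalities makes `gen i * x` a multiple of the longest element on
the three generators, of type $A_1\times A_2$ or $A_3$. -/
theorem meet_trans_far_adj {N : ℕ} (H : ReducesUpTo n N) {i k j : Fin n} (hik : Far i k)
    (hkj : Adj k j) (hij : i ≠ j) {x v y : BraidMonoid n} (hx : len x ≤ N)
    (h₁ : Meet i k x v) (h₂ : Meet k j v y) : Meet i j x y := by
  obtain ⟨p, rfl, rfl⟩ := h₁.of_far hik
  obtain ⟨q, e, rfl⟩ := h₂.of_adj hkj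
  have l := congrArg len e
  simp at hx l
  have h := H _ _ _ _ (by omega) e
  rcases eq_or_far_or_adj i j with h0 | h0 | h0
  · exact absurd h0 hij
  · obtain ⟨z, rfl, e'⟩ := h.of_far h0
    have l' := congrArg len e'
    simp at hx l l'
    obtain ⟨w, rfl, rfl⟩ := (H _ _ _ _ (by omega) e').of_far hik.symm
    refine Or.inr (Or.inl ⟨h0, gen k * (gen j * w), ?_, ?_⟩)
    · rw [gen_braid_assoc hkj]
    · rw [gen_comm_assoc h0.symm, gen_comm_assoc hik.symm]
  · obtain ⟨z, rfl, e'⟩ := h.of_adj h0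
    have l' := congrArg len e'
    simp at hx l l'
    obtain ⟨w, rfl, e''⟩ := (H _ _ _ _ (by omega) e').of_far hik.symm
    have l'' := congrArg len e''
    simp at hx l l' l''
    obtain ⟨u, rfl, rfl⟩ := (H _ _ _ _ (by omega) e'').of_adj hkj.symm
    refine Or.inr (Or.inr ⟨h0, gen k * (gen j * (gen i * u)), ?_, ?_⟩)
    · rw [gen_comm_assoc hik, gen_braid_assoc hkj, gen_braid_assoc h0.symm,
        gen_comm_assoc hik.symm]
    · rw [gen_braid_assoc h0.symm, gen_comm_assoc hik.symm, gen_comm_assoc hik u,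
        gen_braid_assoc hkj]

/-- The heart of the reduction lemma, by cases on the Coxeter diagram of `i`, `k`, `j`. Stripping a
letter makes `H` applicable. -/
theorem meet_trans {N : ℕ} (H : ReducesUpTo n N) {i k j : Fin n} {x v y : BraidMonoid n}
    (hx : len x ≤ N) (hy : len y ≤ N)
    (h₁ : Meet i k x v) (h₂ : Meet k j v y) : Meet i j x y := by
  have hik := eq_or_far_or_adj i k
  have hkj := eq_or_far_or_adj k j
  rcases eq_or_ne i k with rfl | nik
  · rw [h₁.eq]; exact h₂
  rcases eq_or_ne k j with rfl | nkj
  · rw [← h₂.eq]; exact h₁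
  rcases hik with hik | hik | hik
  · exact absurd hik nik
  · rcases hkj with hkj | hkj | hkj
    · exact absurd hkj nkj
    · obtain ⟨p, rfl, rfl⟩ := h₁.of_far hik
      obtain ⟨q, e, rfl⟩ := h₂.of_far hkj
      simp at hx
      rcases H _ _ _ _ (by omega) e with ⟨rfl, rfl⟩ | ⟨h0, z, rfl, rfl⟩ | ⟨h0, z, rfl, rfl⟩
      · exact Or.inl ⟨rfl, rfl⟩
      · refine Or.inr (Or.inl ⟨h0, gen k * z, ?_, ?_⟩)
        · rw [gen_comm_assoc hkj]
        · rw [gen_comm_assoc hik]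
      · refine Or.inr (Or.inr ⟨h0, gen k * z, ?_, ?_⟩)
        · rw [gen_comm_assoc hkj, gen_comm_assoc hik]
        · rw [gen_comm_assoc hik.symm, gen_comm_assoc hkj]
    · rcases eq_or_ne i j with rfl | nij
      · exact absurd hkj.symm hik.not_adj
      · exact meet_trans_far_adj H hik hkj nij hx h₁ h₂
  · rcases hkj with hkj | hkj | hkj
    · exact absurd hkj nkj
    · rcases eq_or_ne i j with rfl | nij
      · exact absurd hik.symm hkj.not_adj
      · exact (meet_trans_far_adj H hkj.symm hik.symm nij.symm hy h₂.symm h₁.symm).symm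
    · obtain ⟨p, rfl, rfl⟩ := h₁.of_adj hik
      obtain ⟨q, e, rfl⟩ := h₂.of_adj hkj
      have l := congrArg len e
      simp at hx l
      rcases H _ _ _ _ (by simp; omega) e with ⟨rfl, e'⟩ | ⟨h0, z, e₁, e₂⟩ | ⟨h0, _⟩
      · rw [(H _ _ _ _ (by omega) e').eq]
        exact Or.inl ⟨rfl, rfl⟩
      · have l₁ := congrArg len e₁
        have l₂ := congrArg len e₂
        simp at l₁ l₂
        obtain ⟨z₁, rfl, rfl⟩ := (H _ _ _ _ (by omega) e₁).of_adj hkj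
        obtain ⟨z₂, rfl, e₃⟩ := (H _ _ _ _ (by omega) e₂).of_adj hik.symm
        have l₃ := congrArg len e₃
        simp at hx l l₁ l₂ l₃
        have e' := (H _ _ _ _ (by simp; omega) e₃).eq
        obtain ⟨u, rfl, rfl⟩ := (H _ _ _ _ (by omega) e').of_far h0.symm
        refine Or.inr (Or.inl ⟨h0, gen k * (gen j * (gen i * (gen k * u))), ?_, ?_⟩)
        · rw [gen_comm_assoc h0, gen_braid_assoc hik, gen_braid_assoc hkj]
        · rw [gen_comm_assoc h0.symm, gen_braid_assoc hkj.symm, gen_braid_assoc hik.symm,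
            gen_comm_assoc h0]
      -- The diagram has no triangle: two neighbours of `k` differ by 0 or 2.
      · unfold Adj at *
        omega

/-- Two words are both empty, or the `Meet` relation holds between their heads and tails. -/
def WordMeet (u v : FreeMonoid (Fin n)) : Prop :=
  (u = 1 ∧ v = 1) ∨ ∃ i j u' v', u = FreeMonoid.of i * u' ∧ v = FreeMonoid.of j * v' ∧
    Meet i j (PresentedMonoid.mk (BraidRel n) u') (PresentedMonoid.mk (BraidRel n) v')

theorem wordMeet_refl (u : FreeMonoid (Fin n)) : WordMeet u u := by
  induction u using FreeMonoid.inductionOn' with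
  | one => exact Or.inl ⟨rfl, rfl⟩
  | of_mul i w _ => exact Or.inr ⟨i, i, w, w, rfl, rfl, Or.inl ⟨rfl, rfl⟩⟩

theorem of_mul_inj {i j : Fin n} {u v : FreeMonoid (Fin n)}
    (h : FreeMonoid.of i * u = FreeMonoid.of j * v) : i = j ∧ u = v := by
  have h' := congrArg FreeMonoid.toList h
  simpa using h'

theorem one_ne_of_mul {i : Fin n} {u : FreeMonoid (Fin n)} : 1 ≠ FreeMonoid.of i * u := by
  intro h
  have h' := congrArg FreeMonoid.length h
  simp at h'
  omega

theorem WordMeet.trans {N : ℕ} (H : ReducesUpTo n N) {u v w : FreeMonoid (Fin n)}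
    (hu : u.length ≤ N + 1) (hw : w.length ≤ N + 1)
    (h₁ : WordMeet u v) (h₂ : WordMeet v w) : WordMeet u w := by
  rcases h₁ with ⟨rfl, rfl⟩ | ⟨i, k, u', v', rfl, rfl, m₁⟩
  · exact h₂
  rcases h₂ with ⟨h, _⟩ | ⟨k', j, v'', w', h, rfl, m₂⟩
  · exact absurd h.symm one_ne_of_mul
  obtain ⟨rfl, rfl⟩ := of_mul_inj h
  simp at hu hw
  exact Or.inr ⟨i, j, u', w', rfl, rfl, meet_trans H (by rw [len_mk]; omega)
    (by rw [len_mk]; omega) m₁ m₂⟩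

/-- Induction on the generated congruence; only transitivity needs `H`. The relations are
homogeneous, so the length bound carries over to intermediate words. -/
theorem wordMeet_of_rel {N : ℕ} (H : ReducesUpTo n N) {u v : FreeMonoid (Fin n)}
    (h : ConGen.Rel (BraidRel n) u v) (hu : u.length ≤ N + 1) : WordMeet u v := by
  have hlen {u v : FreeMonoid (Fin n)} (h : ConGen.Rel (BraidRel n) u v) :
      u.length = v.length := by
    rw [← len_mk, ← len_mk]
    exact congrArg len (PresentedMonoid.mk_eq_mk_iff.2 h)
  induction h with
  | of u v h =>
    rcases h with ⟨i, j, h⟩ | ⟨i, j, h⟩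
    · exact Or.inr ⟨i, j, _, _, rfl, rfl, Or.inr (Or.inl ⟨(far_iff i j).2 h, 1,
        (mul_one _).symm, (mul_one _).symm⟩)⟩
    · exact Or.inr ⟨i, j, _, _, mul_assoc _ _ _, mul_assoc _ _ _,
        Or.inr (Or.inr ⟨(adj_iff i j).2 h, 1,
          by rw [mul_one, map_mul]; rfl, by rw [mul_one, map_mul]; rfl⟩)⟩
  | refl u => exact wordMeet_refl u
  | symm h ih =>
    rcases ih (by rw [hlen h]; exact hu) with ⟨h₁, h₂⟩ | ⟨i, j, u', v', h₁, h₂, m⟩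
    · exact Or.inl ⟨h₂, h₁⟩
    · exact Or.inr ⟨j, i, v', u', h₂, h₁, m.symm⟩
  | trans h₁ h₂ ih₁ ih₂ =>
    have l₁ := hlen h₁
    have l₂ := hlen h₂
    exact (ih₁ hu).trans H hu (by omega) (ih₂ (by omega))
  | mul h₁ h₂ ih₁ ih₂ =>
    rw [FreeMonoid.length_mul] at hu
    rcases ih₁ (by omega) with ⟨rfl, rfl⟩ | ⟨i, j, u', v', rfl, rfl, m⟩
    · simpa using ih₂ (by omega)
    · refine Or.inr ⟨i, j, _, _, mul_assoc _ _ _, mul_assoc _ _ _, ?_⟩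
      rw [map_mul, map_mul, PresentedMonoid.mk_eq_mk_iff.2 h₂]
      exact m.mul_right _

theorem reducesUpTo (n N : ℕ) : ReducesUpTo n N := by
  induction N with
  | zero => intro i j x y h; omega
  | succ N H =>
    intro i j x y hx h
    obtain ⟨u, rfl⟩ := PresentedMonoid.surjective_mk (rels := BraidRel n) x
    obtain ⟨v, rfl⟩ := PresentedMonoid.surjective_mk (rels := BraidRel n) y
    have h' : PresentedMonoid.mk (BraidRel n) (FreeMonoid.of i * u) =
        PresentedMonoid.mk (BraidRel n) (FreeMonoid.of j * v) := by
      rw [map_mul, map_mul]; exact h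
    rw [len_mk] at hx
    rcases wordMeet_of_rel H ((Con.eq _).1 h') (by simp; omega) with
      ⟨h, _⟩ | ⟨i', j', u', v', h₁, h₂, m⟩
    · exact absurd h.symm one_ne_of_mul
    · obtain ⟨rfl, rfl⟩ := of_mul_inj h₁
      obtain ⟨rfl, rfl⟩ := of_mul_inj h₂
      exact m

theorem meet_of_gen_mul_eq {i j : Fin n} {x y : BraidMonoid n} (h : gen i * x = gen j * y) :
    Meet i j x y :=
  reducesUpTo n (len x + 1) i j x y (Nat.lt_succ_self _) h

@[elab_as_elim]
theorem gen_mul_induction {P : BraidMonoid n → Prop} (one : P 1)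
    (gen_mul : ∀ i x, P x → P (gen i * x)) (x : BraidMonoid n) : P x := by
  obtain ⟨u, rfl⟩ := PresentedMonoid.surjective_mk (rels := BraidRel n) x
  induction u using FreeMonoid.inductionOn' with
  | one => exact one
  | of_mul i w ih => exact gen_mul i _ ih

theorem mul_left_cancel' {x y z : BraidMonoid n} (h : x * y = x * z) : y = z := by
  induction x using gen_mul_induction with
  | one => simpa using h
  | gen_mul i x ih =>
    rw [mul_assoc, mul_assoc] at h
    exact ih (meet_of_gen_mul_eq h).eq

/-! ### Garside elements of runs as least common multiples. -/

/-- The generators of the braid monoid indexed by `ℕ`, with value `1` beyond the range. -/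
def atom (n i : ℕ) : BraidMonoid n := if h : i < n then gen ⟨i, h⟩ else 1

theorem atom_of_lt {i : ℕ} (h : i < n) : atom n i = gen ⟨i, h⟩ := dif_pos h

theorem len_atom {i : ℕ} (h : i < n) : len (atom n i) = 1 := by rw [atom_of_lt h, len_gen]

theorem atom_commute {i j : ℕ} (h : i + 1 < j ∨ j + 1 < i) : Commute (atom n i) (atom n j) := by
  unfold atom
  split_ifs with hi hj
  · exact gen_comm h
  all_goals simp

theorem atom_braid_assoc {i : ℕ} (h : i + 1 < n) (x : BraidMonoid n) :
    atom n i * (atom n (i + 1) * (atom n i * x)) =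
      atom n (i + 1) * (atom n i * (atom n (i + 1) * x)) := by
  rw [atom_of_lt h, atom_of_lt (Nat.lt_of_succ_lt h)]
  exact gen_braid_assoc (Or.inl rfl) x

theorem atom_dvd_of_dvd_atom_mul {i j : ℕ} (hi : i < n) (hj : j < n)
    (h : i + 1 < j ∨ j + 1 < i) {x : BraidMonoid n} (hx : atom n j ∣ atom n i * x) :
    atom n j ∣ x := by
  rw [atom_of_lt hi, atom_of_lt hj] at *
  obtain ⟨y, e⟩ := hx
  obtain ⟨z, rfl, _⟩ := (meet_of_gen_mul_eq e).of_far h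
  exact Dvd.intro _ rfl

theorem exists_of_atom_mul_eq {i : ℕ} (hi : i + 1 < n) {x y : BraidMonoid n}
    (h : atom n (i + 1) * x = atom n i * y) :
    ∃ z, y = atom n (i + 1) * (atom n i * z) := by
  rw [atom_of_lt hi, atom_of_lt (Nat.lt_of_succ_lt hi)] at *
  obtain ⟨z, _, h⟩ := (meet_of_gen_mul_eq h).of_adj (Or.inr rfl)
  exact ⟨z, h⟩

/-- The descending product `a_{p+m-1} ⋯ a_p` of `m` consecutive generators. -/
def descProd (n p : ℕ) : ℕ → BraidMonoid n
  | 0 => 1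
  | m + 1 => atom n (p + m) * descProd n p m

/-- The Garside element of the run of generators `a_p, …, a_{p+m-1}`. -/
def garside (n p : ℕ) : ℕ → BraidMonoid n
  | 0 => 1
  | m + 1 => garside n p m * descProd n p (m + 1)

theorem len_descProd {p m : ℕ} (h : p + m ≤ n) : len (descProd n p m) = m := by
  induction m with
  | zero => simp [descProd]
  | succ m ih =>
    rw [descProd, len_mul, len_atom (by omega), ih (by omega)]
    omega

theorem len_garside {p m : ℕ} (h : p + m ≤ n) : len (garside n p m) = (m + 1).choose 2 := by
  induction m with
  | zero => simp [garside]
  | succ m ih =>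
    rw [garside, len_mul, len_descProd h, ih (by omega), Nat.choose_succ_succ' (m + 1) 1]
    simp
    omega

theorem atom_commute_descProd {j p m : ℕ} (h : j + 1 < p ∨ p + m < j) :
    Commute (atom n j) (descProd n p m) := by
  induction m with
  | zero => exact Commute.one_right _
  | succ m ih => exact (atom_commute (by omega)).mul_right (ih (by omega))

theorem atom_commute_garside {j p m : ℕ} (h : j + 1 < p ∨ p + m < j) :
    Commute (atom n j) (garside n p m) := by
  induction m with
  | zero => exact Commute.one_right _
  | succ m ih => exact (ih (by omega)).mul_right (atom_commute_descProd h)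

theorem atom_dvd_descProd_mul {j p m : ℕ} (hj : j < n) (hm : p + m ≤ n)
    (h : j + 1 < p ∨ p + m < j) {x : BraidMonoid n} (hx : atom n j ∣ descProd n p m * x) :
    atom n j ∣ x := by
  induction m with
  | zero => simpa [descProd] using hx
  | succ m ih =>
    rw [descProd, mul_assoc] at hx
    exact ih (by omega) (by omega)
      (atom_dvd_of_dvd_atom_mul (by omega) hj (by omega) hx)

theorem atom_dvd_garside_mul_iff {j p m : ℕ} (hj : j < n) (hm : p + m ≤ n)
    (h : j + 1 < p ∨ p + m < j) {x : BraidMonoid n} :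
    atom n j ∣ garside n p m * x ↔ atom n j ∣ x := by
  constructor
  · intro hx
    induction m generalizing x with
    | zero => simpa [garside] using hx
    | succ m ih =>
      rw [garside, mul_assoc] at hx
      exact atom_dvd_descProd_mul hj hm h (ih (by omega) (by omega) hx)
  · rintro ⟨y, rfl⟩
    exact ⟨garside n p m * y, by
      rw [← mul_assoc, ← mul_assoc, (atom_commute_garside h).eq]⟩

/-- The top letter of the product is adjacent to $a_{p+m}$, so reduction forces a braid pattern; the
lower letters commute with $a_{p+m}$, which therefore passes through to `y`. Cancel and induct. -/
theorem descProd_dvd_of_atom_dvd {p m : ℕ} (hm : p + m < n) {y : BraidMonoid n}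
    (h : atom n (p + m) ∣ descProd n p m * y) : descProd n p (m + 1) ∣ y := by
  induction m generalizing y with
  | zero => simpa [descProd] using h
  | succ m ih =>
    obtain ⟨x, e⟩ := h
    rw [descProd, mul_assoc] at e
    obtain ⟨z, e⟩ := exists_of_atom_mul_eq (i := p + m) (by omega) e.symm
    obtain ⟨y, rfl⟩ := atom_dvd_descProd_mul (j := p + m + 1) (by omega) (by omega) (by omega)
      (Dvd.intro _ e.symm)
    rw [← mul_assoc, ← (atom_commute_descProd (by omega)).eq, mul_assoc] at e
    obtain ⟨w, rfl⟩ := ih (by omega) (Dvd.intro _ (mul_left_cancel' e).symm)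
    exact ⟨w, by rw [descProd.eq_2 n p (m + 1), ← add_assoc, mul_assoc]⟩

theorem atom_dvd_descProd_mul_descProd {p m : ℕ} (hm : p + m < n) :
    atom n (p + m) ∣ descProd n p m * descProd n p (m + 1) := by
  induction m with
  | zero => simp [descProd]
  | succ m ih =>
    obtain ⟨u, e⟩ := ih (by omega)
    have c := (atom_commute_descProd (n := n) (j := p + m + 1) (p := p) (m := m) (by omega)).eq
    refine ⟨atom n (p + m) * (atom n (p + m + 1) * u), ?_⟩
    calc descProd n p (m + 1) * descProd n p (m + 2)
        = atom n (p + m) * (descProd n p m * atom n (p + m + 1) * descProd n p (m + 1)) := by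
          rw [descProd.eq_2 n p (m + 1), descProd.eq_2 n p m, ← add_assoc]
          simp only [mul_assoc]
      _ = atom n (p + m) * (atom n (p + m + 1) * (atom n (p + m) * u)) := by
          rw [← c, mul_assoc, e]
      _ = _ := atom_braid_assoc (by omega) u

/-- The Garside element of a run is the least common multiple of the generators in the run. -/
theorem garside_dvd_iff {p m : ℕ} (hm : p + m ≤ n) {x : BraidMonoid n} :
    garside n p m ∣ x ↔ ∀ i < m, atom n (p + i) ∣ x := by
  induction m with
  | zero => simp [garside]
  | succ m ih =>
    specialize ih (by omega)
    constructor
    · intro h i hi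
      rcases Nat.lt_succ_iff_lt_or_eq.1 hi with hi | rfl
      · exact ih.1 ((Dvd.intro _ rfl).trans h) i hi
      · refine dvd_trans ?_ h
        cases i with
        | zero => simp [garside, descProd]
        | succ i =>
          -- The newest generator commutes with the Garside element two steps back.
          rw [garside, garside, mul_assoc,
            atom_dvd_garside_mul_iff (by omega) (by omega) (by omega)]
          exact atom_dvd_descProd_mul_descProd (by omega)
    · intro h
      obtain ⟨y, rfl⟩ := ih.2 fun i hi => h i (by omega)
      have hy := h m (by omega)
      suffices descProd n p (m + 1) ∣ y by
        obtain ⟨z, rfl⟩ := this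
        exact ⟨z, by rw [garside, mul_assoc]⟩
      cases m with
      | zero => simpa [garside, descProd] using hy
      | succ m =>
        rw [garside, mul_assoc,
          atom_dvd_garside_mul_iff (by omega) (by omega) (by omega)] at hy
        exact descProd_dvd_of_atom_dvd (by omega) hy

/-! ### Generating functions by length. -/

theorem eq_one_of_len_eq_zero {x : BraidMonoid n} (h : len x = 0) : x = 1 := by
  induction x using gen_mul_induction with
  | one => rfl
  | gen_mul i x _ => simp at h

theorem finite_len_eq (n k : ℕ) : {x : BraidMonoid n | len x = k}.Finite := by
  refine ((List.finite_length_eq (Fin n) k).image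
    fun l => PresentedMonoid.mk (BraidRel n) (FreeMonoid.ofList l)).subset fun x hx => ?_
  obtain ⟨w, rfl⟩ := PresentedMonoid.surjective_mk (rels := BraidRel n) x
  refine ⟨w.toList, ?_, rfl⟩
  rw [Set.mem_ofPred_eq, len_mk] at hx
  exact hx

/-- The generating function of a set of positive braids with respect to the length. -/
noncomputable def genFun (S : Set (BraidMonoid n)) : ℤ⟦X⟧ :=
  PowerSeries.mk fun k => (({x | x ∈ S ∧ len x = k}.ncard : ℕ) : ℤ)

theorem genFun_union {S T : Set (BraidMonoid n)} (h : Disjoint S T) :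
    genFun (S ∪ T) = genFun S + genFun T := by
  ext k
  simp only [genFun, map_add, PowerSeries.coeff_mk]
  rw [← Nat.cast_add, ← Set.ncard_union_eq
    (h.mono (fun x hx => hx.1) (fun x hx => hx.1))
    ((finite_len_eq n k).subset fun x hx => hx.2)
    ((finite_len_eq n k).subset fun x hx => hx.2)]
  congr 2
  ext x
  simp only [Set.mem_union, Set.mem_ofPred_eq, or_and_right]

theorem genFun_mul_left (d : BraidMonoid n) (S : Set (BraidMonoid n)) :
    genFun ((d * ·) '' S) = PowerSeries.X ^ len d * genFun S := by
  ext k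
  rw [PowerSeries.coeff_X_pow_mul']
  simp only [genFun, PowerSeries.coeff_mk]
  split_ifs with h
  · rw [← Set.ncard_image_of_injective {x | x ∈ S ∧ len x = k - len d}
      (fun y z (e : d * y = d * z) => mul_left_cancel' e)]
    congr 2
    ext x
    constructor
    · rintro ⟨⟨y, hy, rfl⟩, hl⟩
      simp only [len_mul] at hl
      exact ⟨y, ⟨hy, by omega⟩, rfl⟩
    · rintro ⟨y, ⟨hy, hl⟩, rfl⟩
      exact ⟨⟨y, hy, rfl⟩, by simp only [len_mul]; omega⟩
  · rw [Nat.cast_eq_zero, Set.ncard_eq_zero ((finite_len_eq n k).subset fun x hx => hx.2),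
      Set.eq_empty_iff_forall_notMem]
    rintro _ ⟨⟨y, hy, rfl⟩, hl⟩
    simp only [len_mul] at hl
    omega

theorem genFun_singleton_one : genFun ({1} : Set (BraidMonoid n)) = 1 := by
  ext k
  rw [PowerSeries.coeff_one]
  simp only [genFun, PowerSeries.coeff_mk, Set.mem_singleton_iff]
  split_ifs with h
  · subst h
    have : {x : BraidMonoid n | x = 1 ∧ len x = 0} = {1} := by
      ext x
      simp +contextual
    simp [this]
  · have : {x : BraidMonoid n | x = 1 ∧ len x = k} = ∅ := by
      ext x
      simp only [Set.mem_ofPred_eq, Set.mem_empty_iff_false, iff_false]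
      rintro ⟨rfl, h'⟩
      exact h (by simpa using h'.symm)
    simp [this]

/-! ### Sieving by divisibility. -/

/-- The braids divisible by none of the first `q` generators, and by each of the `m` generators
from `a_p` on. -/
def divSet (n q p m : ℕ) : Set (BraidMonoid n) :=
  {x | (∀ i < q, ¬ atom n i ∣ x) ∧ ∀ i < m, atom n (p + i) ∣ x}

theorem divSet_zero_right (n q p p' : ℕ) : divSet n q p 0 = divSet n q p' 0 := by
  simp [divSet]

theorem divSet_split (n p m : ℕ) :
    divSet n p (p + 1) m = divSet n p p (m + 1) ∪ divSet n (p + 1) (p + 1) m := by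
  ext x
  simp only [divSet, Set.mem_union, Set.mem_ofPred_eq,
    Nat.forall_lt_succ_left (n := m), Nat.forall_lt_succ_right (n := p), add_zero]
  have : ∀ i, p + 1 + i = p + (i + 1) := fun i => by omega
  simp only [this]
  tauto

theorem disjoint_divSet (n p m : ℕ) :
    Disjoint (divSet n p p (m + 1)) (divSet n (p + 1) (p + 1) m) :=
  Set.disjoint_left.2 fun _ hx hx' => hx'.1 p (by omega) (hx.2 0 (by omega))

/-- If `q < p`, the excluded generators are not adjacent to the run, so multiplying by its Garside
element does not affect divisibility by them. -/
theorem divSet_eq_image {q p m : ℕ} (hq : q < p ∨ q = 0) (hm : p + m ≤ n) :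
    divSet n q p m = (garside n p m * ·) '' divSet n q p 0 := by
  ext x
  simp only [divSet, Set.mem_ofPred_eq, ← garside_dvd_iff hm, Set.mem_image, not_lt_zero,
    IsEmpty.forall_iff, implies_true, and_true]
  constructor
  · rintro ⟨h, y, rfl⟩
    exact ⟨y, fun i hi => by
      rw [← atom_dvd_garside_mul_iff (by omega) hm (by omega)]; exact h i hi, rfl⟩
  · rintro ⟨y, h, rfl⟩
    exact ⟨fun i hi => by
      rw [atom_dvd_garside_mul_iff (by omega) hm (by omega)]; exact h i hi, Dvd.intro _ rfl⟩

/-! ### The matching determinant recursion. -/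

/-- The leading `k × k` block of the type `A` matrix, with the exponents in the last column
shifted as if this column were `m` places further to the right. -/
noncomputable def shiftedMatrix (k m : ℕ) : Matrix (Fin k) (Fin k) ℤ[X] :=
  Matrix.of fun i j => if (i : ℕ) ≤ (j : ℕ) + 1 then
    Polynomial.X ^ ((if (j : ℕ) + 1 = k then (j : ℕ) + m else j) + 1 - (i : ℕ)).choose 2 else 0

theorem shiftedMatrix_zero (n : ℕ) : shiftedMatrix (n + 1) 0 = typeAMatrix n := by
  ext i j : 1
  simp [shiftedMatrix, typeAMatrix]

theorem det_shiftedMatrix_one (m : ℕ) :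
    (shiftedMatrix 1 m).det = Polynomial.X ^ (m + 1).choose 2 := by
  simp [shiftedMatrix]

/-- Expansion along the last row, whose only nonzero entries are the subdiagonal $t^{\binom 02}=1$
and the corner. Deleting the column before the last moves the last column one more place out of
step, whence `m + 1`. -/
theorem det_shiftedMatrix_succ (k m : ℕ) :
    (shiftedMatrix (k + 2) m).det =
      Polynomial.X ^ (m + 1).choose 2 * (shiftedMatrix (k + 1) 0).det -
        (shiftedMatrix (k + 1) (m + 1)).det := by
  have h₁ : (shiftedMatrix (k + 2) m).submatrix (Fin.last (k + 1)).succAbove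
      (Fin.last (k + 1)).succAbove = shiftedMatrix (k + 1) 0 := by
    ext i j : 1
    have := j.2
    simp [shiftedMatrix]
    grind
  have h₂ : (shiftedMatrix (k + 2) m).submatrix (Fin.last (k + 1)).succAbove
      (Fin.last k).castSucc.succAbove = shiftedMatrix (k + 1) (m + 1) := by
    ext i j : 1
    have hi := i.2
    refine Fin.lastCases ?_ (fun j => ?_) j
    · simp [shiftedMatrix, show (i : ℕ) ≤ k + 1 + 1 by omega, show (i : ℕ) ≤ k + 1 by omega]
      congr 2
      omega
    · have := j.2
      rw [Matrix.submatrix_apply, Fin.succAbove_of_castSucc_lt _ _ (by simp)]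
      simp [shiftedMatrix, show ¬ (j : ℕ) = k by omega, show ¬ (j : ℕ) = k + 1 by omega]
  rw [Matrix.det_succ_row _ (Fin.last (k + 1)), Fin.sum_univ_castSucc, Fin.sum_univ_castSucc,
    Finset.sum_eq_zero, h₁, h₂]
  · have e : k + 1 + m + 1 - (k + 1) = m + 1 := by omega
    have s : (-1 : ℤ[X]) ^ (k + 1 + k) = -1 := Odd.neg_one_pow ⟨k, by ring⟩
    have s' : (-1 : ℤ[X]) ^ (k + 1 + (k + 1)) = 1 := Even.neg_one_pow ⟨k + 1, rfl⟩
    simp [shiftedMatrix, e, s, s']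
    ring
  · intro j _
    have := j.2
    simp [shiftedMatrix, show ¬ k ≤ (j : ℕ) by omega]

theorem genFun_divSet {p m : ℕ} (h : p + m ≤ n) :
    genFun (divSet n p p m) = genFun (Set.univ : Set (BraidMonoid n)) * ((shiftedMatrix (p + 1) m).det : ℤ⟦X⟧) := by
  induction p generalizing m with
  | zero =>
    rw [divSet_eq_image (Or.inr rfl) h, genFun_mul_left, len_garside h, det_shiftedMatrix_one,
      mul_comm]
    simp [divSet]
  | succ p ih =>
    have e := congrArg genFun (divSet_split n p m)
    rw [genFun_union (disjoint_divSet n p m), divSet_eq_image (Or.inl p.lt_succ_self) h,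
      genFun_mul_left, len_garside h, divSet_zero_right n p (p + 1) p, ih (by omega),
      ih (by omega)] at e
    rw [eq_sub_of_add_eq' e.symm, det_shiftedMatrix_succ]
    push_cast
    ring

theorem divSet_self (n : ℕ) : divSet n n n 0 = {1} := by
  ext x
  simp only [divSet, Set.mem_ofPred_eq, not_lt_zero, IsEmpty.forall_iff, implies_true, and_true,
    Set.mem_singleton_iff]
  constructor
  · intro h
    induction x using gen_mul_induction with
    | one => rfl
    | gen_mul i x _ => exact absurd (by rw [atom_of_lt i.2]; exact Dvd.intro _ rfl) (h i i.2)
  · rintro rfl i hi ⟨y, e⟩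
    have := congrArg len e
    rw [len_mul, len_atom hi, len_one] at this
    omega

theorem genFun_univ_mul_det (n : ℕ) :
    genFun (Set.univ : Set (BraidMonoid n)) * ((typeAMatrix n).det : ℤ⟦X⟧) = 1 := by
  rw [← shiftedMatrix_zero, ← genFun_divSet (by omega), divSet_self, genFun_singleton_one]

/-! ### Atoms and word length. -/

theorem monoidAtoms_eq (n : ℕ) :
    monoidAtoms (BraidMonoid n) = Set.range (PresentedMonoid.of (BraidRel n)) := by
  ext x
  constructor
  · rintro ⟨h₁, h₂⟩
    induction x using gen_mul_induction with
    | one => exact absurd rfl h₁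
    | gen_mul i x _ =>
      rcases h₂ _ _ rfl with h | h
      · exact absurd (congrArg len h) (by simp)
      · exact ⟨i, by rw [h, mul_one]⟩
  · rintro ⟨i, rfl⟩
    have hi : len (PresentedMonoid.of (BraidRel n) i) = 1 := len_gen i
    refine ⟨fun h => by simp [h] at hi, fun x y h => ?_⟩
    rw [h, len_mul] at hi
    rcases Nat.eq_zero_or_pos (len x) with hx | hx
    · exact Or.inl (eq_one_of_len_eq_zero hx)
    · exact Or.inr (eq_one_of_len_eq_zero (by omega))

/-- By homogeneity all words in the atoms for a given braid have the same length, so the minimum is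
`len`. -/
theorem wordSphere_atoms (n k : ℕ) :
    wordSphere (monoidAtoms (BraidMonoid n)) k = {x | len x = k} := by
  rw [monoidAtoms_eq]
  have key (w : List (BraidMonoid n))
      (hw : ∀ s ∈ w, s ∈ Set.range (PresentedMonoid.of (BraidRel n))) :
      len w.prod = w.length := by
    induction w with
    | nil => simp
    | cons s w ih =>
      obtain ⟨i, rfl⟩ := hw s (by simp)
      rw [List.prod_cons, len_mul, ih fun t ht => hw t (by simp [ht]), List.length_cons]
      exact (congrArg (· + w.length) (len_gen i)).trans (add_comm _ _)
  ext x
  constructor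
  · rintro ⟨⟨w, hw, rfl, rfl⟩, _⟩
    exact key w hw
  · rintro rfl
    refine ⟨?_, ?_⟩
    · induction x using gen_mul_induction with
      | one => exact ⟨[], by simp⟩
      | gen_mul i x ih =>
        obtain ⟨w, hw, rfl, hl⟩ := ih
        refine ⟨gen i :: w, ?_, List.prod_cons, ?_⟩
        · simpa using hw
        · rw [List.length_cons, hl, len_mul, len_gen, add_comm]
    · rintro l ⟨w, hw, rfl, rfl⟩
      exact (key w hw).le

theorem growthSeries_atoms (n : ℕ) :
    growthSeries (monoidAtoms (BraidMonoid n)) = genFun (Set.univ : Set (BraidMonoid n)) := by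
  simp only [growthSeries, genFun, wordSphere_atoms, Set.mem_univ, true_and]

end BraidMonoid

theorem theoremT (n : ℕ) :
    monoidAtoms (BraidMonoid n) = Set.range (PresentedMonoid.of (BraidRel n)) ∧
    (∀ k : ℕ, (wordSphere (monoidAtoms (BraidMonoid n)) k).Finite) ∧
    growthSeries (monoidAtoms (BraidMonoid n)) * ((typeAMatrix n).det : ℤ⟦X⟧) = 1 := by
  refine ⟨BraidMonoid.monoidAtoms_eq n, fun k => ?_, ?_⟩
  · rw [BraidMonoid.wordSphere_atoms]
    exact BraidMonoid.finite_len_eq n k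
  · rw [BraidMonoid.growthSeries_atoms]
    exact BraidMonoid.genFun_univ_mul_det n
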